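/- Let $R$ and $S$ be arbitrary (associative, unital) rings and let ${}_RC_S$ be a semidualizing $(R,S)$-bimodule, that is: ${}_RC$ and $C_S$ admit resolutions by finitely generated projective modules; the homothety maps $R\to\operatorname{Hom}_{S^{op}}(C,C)$ and $S\to\operatorname{Hom}_R(C,C)$ are isomorphisms; and $\operatorname{Ext}_R^{i}(C,C)=0=\operatorname{Ext}_{S^{op}}^{i}(C,C)$ for all $i\ge 1$. Write $(-)_*:=\operatorname{Hom}_R(C,-)$. The Auslander class $\mathcal{A}_C(S)$ consists of the left $S$-modules $N$ such that $\operatorname{Tor}^S_{i}(C,N)=0$ and $\operatorname{Ext}_R^{i}(C,C\otimes_SN)=0$ for all $i\ge 1$, and such that $\mu_N:N\to (C\otimes_SN)_*$, $\mu_N(x)(c)=c\otimes x$, is an isomorphism. The Bass class $\mathcal{B}_C(R)$ consists of the left $R$-modules $M$ such that $\operatorname{Ext}_R^{i}(C,M)=0$ and $\operatorname{Tor}^S_{i}(C,M_*)=0$ for all $i\ge 1$, and such that $\theta_M:C\otimes_SM_*\to M$, $\theta_M(c\otimes \varphi)=\varphi(c)$, is an isomorphism. For a class $\mathcal{X}$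 of modules, an $\mathcal{X}$-preenvelope of a module $Y$ is a homomorphism $f:Y\to X$ with $X\in\mathcal{X}$ such that every homomorphism from $Y$ to a module in $\mathcal{X}$ factors through $f$; it is an $\mathcal{X}$-envelope if moreover every endomorphism $h$ of $X$ with $hf=f$ is an automorphism. The class $\mathcal{X}$ is enveloping if every module (over the ring in question) has an $\mathcal{X}$-envelope. **Theorem.** 1. Let $N$ be a left $S$-module and let $f:C\otimes_SN\to B$ be a $\mathcal{B}_C(R)$-preenvelope of $C\otimes_SN$ in $\operatorname{Mod}R$. Then (1.1) $f_*\mu_N:N\to B_*$ is an $\mathcal{A}_C(S)$-preenvelope of $N$ in $\operatorname{Mod}S$; (1.2) if $f$ is a $\mathcal{B}_C(R)$-envelope of $C\otimes_SN$, then $f_*\mu_N$ is an $\mathcal{A}_C(S)$-envelope of $N$. 2. If $\mathcal{B}_C(R)$ is enveloping in $\operatorname{Mod}R$, then $\mathcal{A}_C(S)$ is enveloping in $\operatorname{Mod}S$. -/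

import Mathlib

open CategoryTheory MulOpposite
open scoped TensorProduct

universe u

/-! ## Preenvelopes and envelopes -/

section Envelopes

variable {𝒞 : Type*} [Category 𝒞]

/-- `f : Y ⟶ X` is an `𝒳`-preenvelope of `Y`: the object `X` belongs to `𝒳`, and the map
`Hom(f, X') : Hom(X, X') → Hom(Y, X')` is surjective for every `X'` in `𝒳`. -/
structure IsPreenvelope (𝒳 : ObjectProperty 𝒞) {Y X : 𝒞} (f : Y ⟶ X) : Prop where
  mem : 𝒳 X
  surjective : ∀ X' : 𝒞, 𝒳 X' → Function.Surjective (fun h : X ⟶ X' => f ≫ h)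

/-- `f : Y ⟶ X` is left minimal: an endomorphism `h` of `X` is an automorphism whenever
`h ∘ f = f`. -/
def IsLeftMinimal {Y X : 𝒞} (f : Y ⟶ X) : Prop :=
  ∀ h : X ⟶ X, f ≫ h = f → IsIso h

/-- An `𝒳`-envelope is a left minimal `𝒳`-preenvelope. -/
structure IsEnvelope (𝒳 : ObjectProperty 𝒞) {Y X : 𝒞} (f : Y ⟶ X) : Prop
    extends IsPreenvelope 𝒳 f where
  leftMinimal : IsLeftMinimal f

/-- `𝒳` is enveloping: every object admits an `𝒳`-envelope. -/
def IsEnveloping (𝒳 : ObjectProperty 𝒞) : Prop :=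
  ∀ Y : 𝒞, ∃ (X : 𝒞) (f : Y ⟶ X), IsEnvelope 𝒳 f

end Envelopes

/-! ## Tensor product over a noncommutative ring and Hom, for an `(R, S)`-bimodule `C`

An `(R, S)`-bimodule is an abelian group `C` with commuting structures of a left `R`-module and of
a left `Sᵐᵒᵖ`-module, that is, of a right `S`-module: `c s` is `op s • c`. -/

section Bimodule

variable (R S : Type u) [Ring R] [Ring S]
variable (C : Type u) [AddCommGroup C] [Module R C] [Module Sᵐᵒᵖ C] [SMulCommClass R Sᵐᵒᵖ C]

/-- The subgroup of `C ⊗_ℤ N` generated by the elements `c s ⊗ n - c ⊗ s n`. It is stable under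
the action of `R` on the left factor. -/
noncomputable def balancing (N : Type u) [AddCommGroup N] [Module S N] :
    Submodule R (C ⊗[ℤ] N) where
  toAddSubmonoid := (AddSubgroup.closure
    {x : C ⊗[ℤ] N | ∃ (c : C) (s : S) (n : N),
      x = (op s • c) ⊗ₜ[ℤ] n - c ⊗ₜ[ℤ] (s • n)}).toAddSubmonoid
  smul_mem' r x hx := by
    change x ∈ AddSubgroup.closure _ at hx
    change r • x ∈ AddSubgroup.closure _
    induction hx using AddSubgroup.closure_induction with
    | mem x hx =>
      obtain ⟨c, s, n, rfl⟩ := hx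
      refine AddSubgroup.subset_closure ⟨r • c, s, n, ?_⟩
      rw [smul_sub, TensorProduct.smul_tmul', TensorProduct.smul_tmul', smul_comm]
    | zero => rw [smul_zero]; exact zero_mem _
    | add x y _ _ hx hy => rw [smul_add]; exact add_mem hx hy
    | neg x _ hx => rw [smul_neg]; exact neg_mem hx

/-- The left `R`-module `C ⊗_S N`. -/
abbrev BalTensor (N : Type u) [AddCommGroup N] [Module S N] : Type u :=
  (C ⊗[ℤ] N) ⧸ balancing R S C N

namespace BalTensor

variable {C}

/-- The element `c ⊗ n` of `C ⊗_S N`. -/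
noncomputable def tmul {N : Type u} [AddCommGroup N] [Module S N] (c : C) (n : N) :
    BalTensor R S C N :=
  (balancing R S C N).mkQ (c ⊗ₜ[ℤ] n)

section

variable {N : Type u} [AddCommGroup N] [Module S N]

theorem add_tmul (c c' : C) (n : N) : tmul R S (c + c') n = tmul R S c n + tmul R S c' n := by
  simp only [tmul, TensorProduct.add_tmul, map_add]

theorem tmul_add (c : C) (n n' : N) : tmul R S c (n + n') = tmul R S c n + tmul R S c n' := by
  simp only [tmul, TensorProduct.tmul_add, map_add]

theorem smul_tmul (r : R) (c : C) (n : N) : tmul R S (r • c) n = r • tmul R S c n := by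
  simp only [tmul, ← map_smul, TensorProduct.smul_tmul']

theorem op_smul_tmul (s : S) (c : C) (n : N) : tmul R S (op s • c) n = tmul R S c (s • n) := by
  rw [← sub_eq_zero]
  simp only [tmul, ← map_sub]
  rw [Submodule.mkQ_apply, Submodule.Quotient.mk_eq_zero]
  exact AddSubgroup.subset_closure ⟨c, s, n, rfl⟩

theorem hom_ext {M : Type u} [AddCommGroup M] [Module R M] {f g : BalTensor R S C N →ₗ[R] M}
    (h : ∀ c n, f (tmul R S c n) = g (tmul R S c n)) : f = g := by
  refine Submodule.linearMap_qext _ (LinearMap.ext fun x => ?_)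
  induction x with
  | zero => simp only [map_zero]
  | tmul c n => exact h c n
  | add x y hx hy => simp only [map_add, hx, hy]

/-- The `R`-linear map `C ⊗_S N → M`, `c ⊗ n ↦ φ c n`, given by a biadditive map `φ` that is
`R`-linear in the first variable and satisfies `φ (c s) n = φ c (s n)`. -/
noncomputable def lift {M : Type u} [AddCommGroup M] [Module R M] (φ : C →+ N →+ M)
    (hR : ∀ (r : R) (c : C) (n : N), φ (r • c) n = r • φ c n)
    (hS : ∀ (s : S) (c : C) (n : N), φ (op s • c) n = φ c (s • n)) :
    BalTensor R S C N →ₗ[R] M :=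
  (balancing R S C N).liftQ
    { toFun := TensorProduct.liftAddHom φ (fun z c n => by simp)
      map_add' := fun x y => map_add _ x y
      map_smul' := fun r x => by
        induction x with
        | zero => simp only [smul_zero, map_zero]
        | tmul c n =>
          rw [TensorProduct.smul_tmul']
          exact hR r c n
        | add x y hx hy => rw [smul_add, map_add, map_add, hx, hy, smul_add] }
    (by
      intro x hx
      change x ∈ AddSubgroup.closure _ at hx
      rw [LinearMap.mem_ker]
      induction hx using AddSubgroup.closure_induction with
      | mem x hx =>
        obtain ⟨c, s, n, rfl⟩ := hx
        rw [map_sub, sub_eq_zero]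
        exact hS s c n
      | zero => exact map_zero _
      | add x y _ _ hx hy => rw [map_add, hx, hy, add_zero]
      | neg x _ hx => rw [map_neg, hx, neg_zero])

@[simp]
theorem lift_tmul {M : Type u} [AddCommGroup M] [Module R M] (φ : C →+ N →+ M)
    (hR : ∀ (r : R) (c : C) (n : N), φ (r • c) n = r • φ c n)
    (hS : ∀ (s : S) (c : C) (n : N), φ (op s • c) n = φ c (s • n)) (c : C) (n : N) :
    lift R S φ hR hS (tmul R S c n) = φ c n :=
  rfl

end

variable (C)

/-- The map `1_C ⊗ g : C ⊗_S N → C ⊗_S N'`. -/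
noncomputable def map {N N' : Type u} [AddCommGroup N] [Module S N] [AddCommGroup N'] [Module S N']
    (g : N →ₗ[S] N') : BalTensor R S C N →ₗ[R] BalTensor R S C N' :=
  lift R S
    (AddMonoidHom.mk' (fun c => AddMonoidHom.mk' (fun n => tmul R S c (g n))
        (fun n n' => by rw [map_add, tmul_add]))
      (fun c c' => by ext n; exact add_tmul R S c c' (g n)))
    (fun r c n => smul_tmul R S r c (g n))
    (fun s c n => by
      change tmul R S (op s • c) (g n) = tmul R S c (g (s • n))
      rw [op_smul_tmul, map_smul])

@[simp]
theorem map_tmul {N N' : Type u} [AddCommGroup N] [Module S N] [AddCommGroup N'] [Module S N']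
    (g : N →ₗ[S] N') (c : C) (n : N) : map R S C g (tmul R S c n) = tmul R S c (g n) :=
  rfl

end BalTensor

/-- The functor `C ⊗_S - : Mod S ⥤ Mod R`. -/
noncomputable def tensorFunctor : ModuleCat.{u} S ⥤ ModuleCat.{u} R where
  obj N := ModuleCat.of R (BalTensor R S C N)
  map g := ModuleCat.ofHom (BalTensor.map R S C g.hom)
  map_id N := by
    ext1
    exact BalTensor.hom_ext R S fun c n => rfl
  map_comp g g' := by
    ext1
    exact BalTensor.hom_ext R S fun c n => rfl

instance tensorFunctor_additive : (tensorFunctor R S C).Additive where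
  map_add {N N' g g'} := by
    ext1
    exact BalTensor.hom_ext R S fun c n => BalTensor.tmul_add R S c (g.hom n) (g'.hom n)

/-- `Tor_i^S(C, -)`, the `i`-th left derived functor of `C ⊗_S -`. -/
noncomputable def torFunctor (i : ℕ) : ModuleCat.{u} S ⥤ ModuleCat.{u} R :=
  (tensorFunctor R S C).leftDerived i

/-- The abelian group `Hom_R(C, M)`, as the carrier of a left `S`-module. -/
def HomFrom (M : Type u) [AddCommGroup M] [Module R M] : Type u := C →ₗ[R] M

namespace HomFrom

variable (M : Type u) [AddCommGroup M] [Module R M]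

instance : AddCommGroup (HomFrom R C M) := inferInstanceAs (AddCommGroup (C →ₗ[R] M))

variable {S C M} in
/-- `s • f` is the map `c ↦ f (c s)`. -/
def smulMap (s : S) (f : C →ₗ[R] M) : C →ₗ[R] M where
  toFun c := f (op s • c)
  map_add' c c' := by rw [smul_add, map_add]
  map_smul' r c := by rw [RingHom.id_apply, ← map_smul, ← smul_comm r (op s) c]

section

variable {S C M} (f : C →ₗ[R] M)

theorem one_smulMap : smulMap R (1 : S) f = f :=
  LinearMap.ext fun c => congrArg f (one_smul Sᵐᵒᵖ c)

theorem mul_smulMap (s t : S) : smulMap R (s * t) f = smulMap R s (smulMap R t f) :=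
  LinearMap.ext fun c => congrArg f (mul_smul (op t) (op s) c)

theorem add_smulMap (s t : S) : smulMap R (s + t) f = smulMap R s f + smulMap R t f :=
  LinearMap.ext fun c => (congrArg f (add_smul (op s) (op t) c)).trans (map_add f _ _)

theorem zero_smulMap : smulMap R (0 : S) f = 0 :=
  LinearMap.ext fun c => (congrArg f (zero_smul Sᵐᵒᵖ c)).trans (map_zero f)

end

/-- `Hom_R(C, M)` is a left `S`-module by `(s f) c = f (c s)`. -/
instance : Module S (HomFrom R C M) where
  smul s f := smulMap R s f
  one_smul f := one_smulMap R f
  mul_smul s t f := mul_smulMap R f s t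
  smul_zero _ := rfl
  smul_add _ _ _ := rfl
  add_smul s t f := add_smulMap R f s t
  zero_smul f := zero_smulMap R f

end HomFrom

/-- The functor `(-)_* = Hom_R(C, -) : Mod R ⥤ Mod S`. -/
def homFunctor : ModuleCat.{u} R ⥤ ModuleCat.{u} S where
  obj M := ModuleCat.of S (HomFrom R C M)
  map {M M'} f := ModuleCat.ofHom
    { toFun := fun φ : C →ₗ[R] M => (f.hom ∘ₗ φ : C →ₗ[R] M')
      map_add' := fun φ ψ => LinearMap.comp_add φ ψ f.hom
      map_smul' := fun _ _ => rfl }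

/-- The canonical map `μ_N : N → Hom_R(C, C ⊗_S N)`, `μ_N n c = c ⊗ n`. -/
noncomputable def muMap (N : ModuleCat.{u} S) :
    N ⟶ (homFunctor R S C).obj ((tensorFunctor R S C).obj N) :=
  ModuleCat.ofHom
    { toFun := fun n =>
        ({ toFun := fun c => BalTensor.tmul R S c n
           map_add' := fun c c' => BalTensor.add_tmul R S c c' n
           map_smul' := fun r c => BalTensor.smul_tmul R S r c n } :
          C →ₗ[R] BalTensor R S C N)
      map_add' := fun n n' => LinearMap.ext fun c => BalTensor.tmul_add R S c n n'
      map_smul' := fun s n => LinearMap.ext fun c => (BalTensor.op_smul_tmul R S s c n).symm }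

/-- The canonical map `θ_M : C ⊗_S Hom_R(C, M) → M`, `θ_M (c ⊗ f) = f c`. -/
noncomputable def thetaMap (M : ModuleCat.{u} R) :
    (tensorFunctor R S C).obj ((homFunctor R S C).obj M) ⟶ M :=
  ModuleCat.ofHom (BalTensor.lift R S (N := HomFrom R C M)
    (AddMonoidHom.mk' (fun c => AddMonoidHom.mk' (fun f : C →ₗ[R] M => f c) (fun _ _ => rfl))
      (fun c c' => AddMonoidHom.ext fun f : C →ₗ[R] M => map_add f c c'))
    (fun r c (f : C →ₗ[R] M) => map_smul f r c)
    (fun _ _ _ => rfl))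

/-! ## Semidualizing bimodules, Auslander and Bass classes -/

/-- `M` has a projective resolution all of whose terms are finitely generated. -/
def HasDegreewiseFiniteResolution {A : Type u} [Ring A] (M : ModuleCat.{u} A) : Prop :=
  ∃ P : ProjectiveResolution M, ∀ n : ℕ, Module.Finite A (P.complex.X n)

/-- `Ext_A^i(M, M') = 0` for all `i ≥ 1`. -/
def ExtVanishes {A : Type u} [Ring A] (M M' : ModuleCat.{u} A) : Prop :=
  ∀ i : ℕ, 1 ≤ i → Subsingleton (Abelian.Ext M M' i)

/-- The `(R, S)`-bimodule `C` is semidualizing. -/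
structure IsSemidualizing : Prop where
  finite_left : HasDegreewiseFiniteResolution (ModuleCat.of R C)
  finite_right : HasDegreewiseFiniteResolution (ModuleCat.of Sᵐᵒᵖ C)
  /-- The homothety map `R → Hom_{Sᵒᵖ}(C, C)`, `r ↦ (c ↦ r c)`, is an isomorphism. -/
  homothety_left : Function.Bijective
    (fun r : R => (DistribSMul.toLinearMap Sᵐᵒᵖ C r : C →ₗ[Sᵐᵒᵖ] C))
  /-- The homothety map `S → Hom_R(C, C)`, `s ↦ (c ↦ c s)`, is an isomorphism. -/
  homothety_right : Function.Bijective
    (fun s : S => (HomFrom.smulMap R s LinearMap.id : C →ₗ[R] C))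
  ext_left : ExtVanishes (ModuleCat.of R C) (ModuleCat.of R C)
  ext_right : ExtVanishes (ModuleCat.of Sᵐᵒᵖ C) (ModuleCat.of Sᵐᵒᵖ C)

/-- The Auslander class `𝒜_C(S)` in `Mod S`. -/
structure AuslanderClass (N : ModuleCat.{u} S) : Prop where
  tor_vanishes : ∀ i : ℕ, 1 ≤ i → Limits.IsZero ((torFunctor R S C i).obj N)
  ext_vanishes : ExtVanishes (ModuleCat.of R C) ((tensorFunctor R S C).obj N)
  mu_iso : IsIso (muMap R S C N)

/-- The Bass class `ℬ_C(R)` in `Mod R`. -/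
structure BassClass (M : ModuleCat.{u} R) : Prop where
  ext_vanishes : ExtVanishes (ModuleCat.of R C) M
  tor_vanishes : ∀ i : ℕ, 1 ≤ i →
    Limits.IsZero ((torFunctor R S C i).obj ((homFunctor R S C).obj M))
  theta_iso : IsIso (thetaMap R S C M)

end Bimodule

/-! The functors `C ⊗_S -` and `Hom_R(C, -)` are adjoint with unit `μ` and counit `θ`, and the
composite in the theorem is the adjoint transpose of `f`. The triangle identities show that the two
functors exchange the Auslander and Bass classes, where `μ` and `θ` are invertible
(`BassClass.auslanderClass_obj`, `AuslanderClass.bassClass_obj`). The rest is formal for any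
adjunction: factorizations and left minimality pass from `f` to its transpose
(`IsPreenvelope.unit_comp_map`, `IsLeftMinimal.unit_comp_map`). For the last claim, an envelope of
`N` comes from transposing a Bass envelope of `C ⊗_S N`. -/

section Adjunction

variable (R S : Type u) [Ring R] [Ring S]
variable (C : Type u) [AddCommGroup C] [Module R C] [Module Sᵐᵒᵖ C] [SMulCommClass R Sᵐᵒᵖ C]

/-- The adjunction between `C ⊗_S -` and `Hom_R(C, -)`, with unit `μ` and counit `θ`. -/
noncomputable def tensorHomAdjunction : tensorFunctor R S C ⊣ homFunctor R S C where
  unit :=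
    { app := muMap R S C
      naturality := fun _ _ _ => rfl }
  counit :=
    { app := thetaMap R S C
      naturality := fun M M' f => by
        ext1
        exact BalTensor.hom_ext R S fun c n => rfl }
  left_triangle_components N := by
    ext1
    exact BalTensor.hom_ext R S fun c n => rfl
  right_triangle_components M := rfl

@[simp]
theorem tensorHomAdjunction_unit_app (N : ModuleCat.{u} S) :
    (tensorHomAdjunction R S C).unit.app N = muMap R S C N :=
  rfl

@[simp]
theorem tensorHomAdjunction_counit_app (M : ModuleCat.{u} R) :
    (tensorHomAdjunction R S C).counit.app M = thetaMap R S C M :=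
  rfl

theorem ExtVanishes.of_iso {A : Type u} [Ring A] {X Y Y' : ModuleCat.{u} A}
    (h : ExtVanishes X Y) (e : Y ≅ Y') : ExtVanishes X Y' := fun i hi => by
  have : Subsingleton ((Abelian.extFunctorObj X i).obj Y) := h i hi
  exact ((Abelian.extFunctorObj X i).mapIso e).addCommGroupIsoToAddEquiv.symm.toEquiv.subsingleton

variable {R S C}

/-- The Tor condition is literally the same, and Ext vanishing transports along `θ_B`. By a triangle
identity `μ` at `B_*` is a right inverse followed by the isomorphism `(θ_B)_*`, hence invertible. -/
theorem BassClass.auslanderClass_obj {B : ModuleCat.{u} R} (hB : BassClass R S C B) :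
    AuslanderClass R S C ((homFunctor R S C).obj B) where
  tor_vanishes := hB.tor_vanishes
  ext_vanishes := by
    have := hB.theta_iso
    exact hB.ext_vanishes.of_iso (asIso (thetaMap R S C B)).symm
  mu_iso := by
    have := hB.theta_iso
    have h := (tensorHomAdjunction R S C).right_triangle_components B
    simp only [tensorHomAdjunction_unit_app, tensorHomAdjunction_counit_app] at h
    have : IsIso (muMap R S C ((homFunctor R S C).obj B) ≫
        (homFunctor R S C).map (thetaMap R S C B)) := by rw [h]; infer_instance
    exact IsIso.of_isIso_comp_right _ ((homFunctor R S C).map (thetaMap R S C B))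

/-- Dual argument: Ext vanishing is the same condition, Tor vanishing transports along `μ_A`, and
the other triangle identity inverts `θ`. -/
theorem AuslanderClass.bassClass_obj {A : ModuleCat.{u} S} (hA : AuslanderClass R S C A) :
    BassClass R S C ((tensorFunctor R S C).obj A) where
  ext_vanishes := hA.ext_vanishes
  tor_vanishes i hi := by
    have := hA.mu_iso
    exact (hA.tor_vanishes i hi).of_iso ((torFunctor R S C i).mapIso (asIso (muMap R S C A)).symm)
  theta_iso := by
    have := hA.mu_iso
    have h := (tensorHomAdjunction R S C).left_triangle_components A
    simp only [tensorHomAdjunction_unit_app, tensorHomAdjunction_counit_app] at h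
    have : IsIso ((tensorFunctor R S C).map (muMap R S C A) ≫
        thetaMap R S C ((tensorFunctor R S C).obj A)) := by rw [h]; infer_instance
    exact IsIso.of_isIso_comp_left ((tensorFunctor R S C).map (muMap R S C A)) _

end Adjunction

/-! ### Transposing preenvelopes and left minimal maps along an adjunction -/

section Transfer

variable {𝒞 𝒟 : Type*} [Category 𝒞] [Category 𝒟] {F : 𝒞 ⥤ 𝒟} {G : 𝒟 ⥤ 𝒞} (adj : F ⊣ G)
  {𝒜 : ObjectProperty 𝒞} {ℬ : ObjectProperty 𝒟} {N : 𝒞} {B : 𝒟} {f : F.obj N ⟶ B}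

theorem IsPreenvelope.unit_comp_map (hf : IsPreenvelope ℬ f)
    (hB : 𝒜 (G.obj B)) (hF : ∀ A, 𝒜 A → ℬ (F.obj A))
    (hunit : ∀ A, 𝒜 A → IsIso (adj.unit.app A)) :
    IsPreenvelope 𝒜 (adj.unit.app N ≫ G.map f) where
  mem := hB
  surjective A hA g := by
    have := hunit A hA
    obtain ⟨h, hh⟩ := hf.surjective _ (hF A hA) (F.map g)
    -- Naturality of the unit turns `η_N ≫ G(F g)` into `g ≫ η_A`, so cancelling `η_A` recovers `g`.
    refine ⟨G.map h ≫ inv (adj.unit.app A), ?_⟩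
    have hh' : f ≫ h = F.map g := hh
    simp [← Functor.map_comp_assoc, hh']

/-- If `h` fixes the transpose of `f`, then `F h`, conjugated by the counit at `B`, fixes `f`.
Minimality makes `F h` invertible, and the invertible unit at `G B` reflects this back to `h`. -/
theorem IsLeftMinimal.unit_comp_map (hf : IsLeftMinimal f)
    [IsIso (adj.counit.app B)] [IsIso (adj.unit.app (G.obj B))] :
    IsLeftMinimal (adj.unit.app N ≫ G.map f) := fun h hh => by
  -- Transposing twice gives back `f`.
  have key : F.map (adj.unit.app N ≫ G.map f) ≫ adj.counit.app B = f := by simp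
  have hf' : f ≫ inv (adj.counit.app B) = F.map (adj.unit.app N ≫ G.map f) := by
    rw [IsIso.comp_inv_eq, key]
  have hiso : IsIso (inv (adj.counit.app B) ≫ F.map h ≫ adj.counit.app B) := by
    apply hf
    rw [reassoc_of% hf', ← Functor.map_comp_assoc, hh, key]
  have hFh : IsIso (F.map h) := by
    have := IsIso.of_isIso_comp_left (inv (adj.counit.app B)) (F.map h ≫ adj.counit.app B)
    exact IsIso.of_isIso_comp_right (F.map h) (adj.counit.app B)
  have hcomp : IsIso (h ≫ adj.unit.app (G.obj B)) := by
    -- The composite becomes the unit at `G B` followed by `G(F h)`, both invertible.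
    rw [← adj.unit_naturality h]
    infer_instance
  exact IsIso.of_isIso_comp_right h (adj.unit.app (G.obj B))

end Transfer

theorem theorem3p7 (R S : Type u) [Ring R] [Ring S]
    (C : Type u) [AddCommGroup C] [Module R C] [Module Sᵐᵒᵖ C] [SMulCommClass R Sᵐᵒᵖ C]
    (hC : IsSemidualizing R S C) :
    (∀ (N : ModuleCat.{u} S) (B : ModuleCat.{u} R) (f : (tensorFunctor R S C).obj N ⟶ B),
      IsPreenvelope (BassClass R S C) f →
        IsPreenvelope (AuslanderClass R S C) (muMap R S C N ≫ (homFunctor R S C).map f) ∧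
        (IsEnvelope (BassClass R S C) f →
          IsEnvelope (AuslanderClass R S C) (muMap R S C N ≫ (homFunctor R S C).map f))) ∧
    (IsEnveloping (BassClass R S C) → IsEnveloping (AuslanderClass R S C)) := by
  have pre : ∀ (N : ModuleCat.{u} S) (B : ModuleCat.{u} R) (f : (tensorFunctor R S C).obj N ⟶ B),
      IsPreenvelope (BassClass R S C) f →
        IsPreenvelope (AuslanderClass R S C) (muMap R S C N ≫ (homFunctor R S C).map f) :=
    fun N B f hf => hf.unit_comp_map (tensorHomAdjunction R S C)
      (BassClass.auslanderClass_obj hf.mem) (fun _ hA => AuslanderClass.bassClass_obj hA)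
      (fun _ hA => AuslanderClass.mu_iso hA)
  have env : ∀ (N : ModuleCat.{u} S) (B : ModuleCat.{u} R) (f : (tensorFunctor R S C).obj N ⟶ B),
      IsEnvelope (BassClass R S C) f →
        IsEnvelope (AuslanderClass R S C) (muMap R S C N ≫ (homFunctor R S C).map f) :=
    fun N B f hf =>
      have hB : BassClass R S C B := hf.mem
      have : IsIso ((tensorHomAdjunction R S C).counit.app B) := hB.theta_iso
      have : IsIso ((tensorHomAdjunction R S C).unit.app ((homFunctor R S C).obj B)) :=
        hB.auslanderClass_obj.mu_iso
      ⟨pre N B f hf.toIsPreenvelope, hf.leftMinimal.unit_comp_map (tensorHomAdjunction R S C)⟩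
  refine ⟨fun N B f hf => ⟨pre N B f hf, env N B f⟩, fun h N => ?_⟩
  obtain ⟨B, f, hf⟩ := h ((tensorFunctor R S C).obj N)
  exact ⟨_, _, env N B f hf⟩
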